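/- Let $n>51$ be an integer such that none of the numbers $n$, $n-1$, $n-2$, $n/2$, $(n-1)/2$, $(n-2)/2$ is a prime (a quotient that is not an integer is not a prime). Let $\mathcal{P}^*(A_n)$ be the proper power graph of the alternating group $A_n$: its vertices are the non-identity elements of $A_n$, and two distinct vertices $x,y$ are adjacent if and only if $y=x^m$ or $x=y^m$ for some positive integer $m$. Write $d(x,y)$ for the length of a shortest path from $x$ to $y$ in $\mathcal{P}^*(A_n)$. For $\sigma\in A_n$ let $S(\sigma)=\{i:\sigma(i)\neq i\}$ be its support. Let $\alpha,\beta\in A_n$ have prime orders $p$ and $q$ respectively, with $p\le q$, and let $m'$ be the number of nontrivial cycles in the factorization of $\beta$ into disjoint cycles. Then $\alpha$ and $\beta$ are joined by a path in $\mathcal{P}^*(A_n)$, and: - if $m'=3$, $n-|S(\beta)|<3$ and $n-|S(\alpha)|<3$, then $d(\alpha,\beta)\le 10$; - otherwise, $d(\alpha,\beta)\le 8$. -/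

import Mathlib

/-- The power graph of a group `G`: distinct `x`, `y` are adjacent iff one of them is a
positive power of the other. -/
def powerGraph (G : Type*) [Group G] : SimpleGraph G where
  Adj x y := x ≠ y ∧ ∃ m : ℕ, 0 < m ∧ (y = x ^ m ∨ x = y ^ m)
  symm := ⟨fun _ _ ⟨hne, m, hm, h⟩ => ⟨hne.symm, m, hm, h.symm⟩⟩
  loopless := ⟨fun _ h => h.1 rfl⟩

/-- The proper power graph of `G`: the power graph with the identity vertex deleted. -/
def properPowerGraph (G : Type*) [Group G] : SimpleGraph {x : G | x ≠ 1} :=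
  (powerGraph G).induce {x : G | x ≠ 1}

/-- An element of prime order is not the identity, so it is a vertex of the proper power graph. -/
theorem ne_one_of_orderOf_prime {G : Type*} [Group G] {x : G} {p : ℕ}
    (hp : p.Prime) (hx : orderOf x = p) : x ≠ 1 := by
  rintro rfl
  rw [orderOf_one] at hx
  exact hp.one_lt.ne hx

/-- The number of (nontrivial) cycles in the disjoint cycle factorization of `σ`. -/
def numCycles {n : ℕ} (σ : Equiv.Perm (Fin n)) : ℕ := σ.cycleType.card

/-- The number of points fixed by `σ`, that is `n - |S(σ)|` with `S(σ)` the support. -/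
def numFixed {n : ℕ} (σ : Equiv.Perm (Fin n)) : ℕ := σ.supportᶜ.card

/-! Commuting elements `x`, `y` of distinct prime orders lie at distance at most two, through `x *
y`; call this a link. It suffices to join the given elements by four links, or five in the
exceptional case, through even permutations of orders 2, 3 and 5. Links come from disjoint supports,
or from permuting the equally long cycles of an element of prime order
(`exists_even_commute_support_eq_biUnion`). By `classification_of_prime_order`, an element of prime
order not 3 has three fixed points, or four cycles, or exactly three cycles. In the first two cases
it has neighbours of order 3 missing a quarter of any large set (`HasSparseThree`). In the last,
permuting its three cycles gives an element with many 3-cycles, which can be permuted away from any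
small set (`HasFlexiblePair`). The four types are then joined pairwise. -/

/-- `x` and `y` are non-identity elements joined by a walk of length `2 * k` in the proper power
graph. -/
def PowerLinked {G : Type*} [Group G] (k : ℕ) (x y : G) : Prop :=
  ∃ (hx : x ≠ 1) (hy : y ≠ 1) (w : (properPowerGraph G).Walk ⟨x, hx⟩ ⟨y, hy⟩), w.length = 2 * k

/-! ### Links in the power graph of an arbitrary group. -/

namespace PowerLinked

variable {G : Type*} [Group G] {x y z : G} {k l : ℕ}

theorem trans (hxy : PowerLinked k x y) (hyz : PowerLinked l y z) : PowerLinked (k + l) x z := by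
  obtain ⟨hx, hy, w, hw⟩ := hxy
  obtain ⟨_, hz, v, hv⟩ := hyz
  exact ⟨hx, hz, w.append v, by rw [SimpleGraph.Walk.length_append, hw, hv, mul_add]⟩

theorem symm (h : PowerLinked k x y) : PowerLinked k y x := by
  obtain ⟨hx, hy, w, hw⟩ := h
  exact ⟨hy, hx, w.reverse, by rw [SimpleGraph.Walk.length_reverse, hw]⟩

theorem reachable_and_dist_le (h : PowerLinked k x y) (hx : x ≠ 1) (hy : y ≠ 1) :
    (properPowerGraph G).Reachable ⟨x, hx⟩ ⟨y, hy⟩ ∧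
      (properPowerGraph G).dist ⟨x, hx⟩ ⟨y, hy⟩ ≤ 2 * k := by
  obtain ⟨_, _, w, hw⟩ := h
  exact ⟨w.reachable, hw ▸ SimpleGraph.dist_le w⟩

/-- In a product of commuting elements of coprime orders, the first factor is a positive power of
the product. -/
theorem exists_mul_pow_eq (hc : Commute x y) (hx : 0 < orderOf x) (hy : 0 < orderOf y)
    (hxy : (orderOf x).Coprime (orderOf y)) : ∃ m : ℕ, 0 < m ∧ (x * y) ^ m = x := by
  obtain ⟨m, hm1, hm0⟩ := Nat.chineseRemainder hxy 1 0
  -- The added product of orders makes the exponent positive and keeps both residues.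
  refine ⟨m + orderOf x * orderOf y, by positivity, ?_⟩
  rw [hc.mul_pow]
  have h1 : x ^ (m + orderOf x * orderOf y) = x := by
    conv_rhs => rw [← pow_one x]
    rw [pow_eq_pow_iff_modEq]
    simpa [Nat.ModEq] using hm1
  have h2 : y ^ (m + orderOf x * orderOf y) = 1 := by
    rw [← pow_zero y, pow_eq_pow_iff_modEq]
    simpa [Nat.ModEq] using hm0
  rw [h1, h2, mul_one]

theorem of_commute (hx : (orderOf x).Prime) (hy : (orderOf y).Prime)
    (hne : orderOf x ≠ orderOf y) (hc : Commute x y) : PowerLinked 1 x y := by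
  have hcop := (Nat.coprime_primes hx hy).2 hne
  have hx1 := ne_one_of_orderOf_prime hx rfl
  have hy1 := ne_one_of_orderOf_prime hy rfl
  have hxy : x * y ≠ 1 := fun h => hne (by rw [eq_inv_of_mul_eq_one_left h, orderOf_inv])
  have key : ∀ {a b : G} (ha : a ≠ 1) (hab : a * b ≠ 1), b ≠ 1 → (orderOf a).Prime →
      (orderOf b).Prime → (orderOf a).Coprime (orderOf b) → Commute a b →
      (properPowerGraph G).Adj ⟨a, ha⟩ ⟨a * b, hab⟩ := by
    intro a b ha hab hb pa pb hcop hc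
    obtain ⟨m, hm, h⟩ := exists_mul_pow_eq hc pa.pos pb.pos hcop
    exact ⟨fun h' => hb (by simpa using h'), m, hm, Or.inr h.symm⟩
  have h1 := key hx1 hxy hy1 hx hy hcop hc
  have h2 := key hy1 (hc.eq ▸ hxy) hx1 hy hx hcop.symm hc.symm
  have h3 : (⟨y * x, hc.eq ▸ hxy⟩ : {x : G | x ≠ 1}) = ⟨x * y, hxy⟩ := Subtype.ext hc.eq.symm
  rw [h3] at h2
  exact ⟨hx1, hy1, .cons h1 (.cons h2.symm .nil), rfl⟩

end PowerLinked

/-! ### Even permutations with prescribed support, and cycles of elements of prime order. -/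

namespace Equiv.Perm

variable {α : Type*} [Fintype α] [DecidableEq α]

theorem exists_isCycle_support_eq {s : Finset α} (hs : 2 ≤ s.card) :
    ∃ ρ : Perm α, ρ.IsCycle ∧ ρ.support = s := by
  refine ⟨s.toList.formPerm, List.isCycle_formPerm s.nodup_toList (by simpa using hs), ?_⟩
  rw [List.support_formPerm_of_nodup _ s.nodup_toList, Finset.toList_toFinset]
  intro x hx
  have := congrArg List.length hx
  simp at this
  omega

/-- The square of a cycle on `s` is an even permutation with support `s`. -/
theorem exists_sq_support_eq {s : Finset α} (hs : 3 ≤ s.card) :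
    ∃ ρ : Perm α, orderOf (ρ ^ 2) = s.card / s.card.gcd 2 ∧ (ρ ^ 2).support = s := by
  obtain ⟨ρ, hρ, rfl⟩ := exists_isCycle_support_eq (s := s) (by omega)
  refine ⟨ρ, by rw [orderOf_pow, hρ.orderOf], ?_⟩
  rw [hρ.support_pow_eq_iff, hρ.orderOf]
  exact fun h => absurd (Nat.le_of_dvd two_pos h) (by omega)

/-- Squares are even. Sets of 3, 4 and 5 points give orders 3, 2 and 5. -/
theorem exists_even_support_eq {s : Finset α} (hs : 3 ≤ s.card) :
    ∃ y : alternatingGroup α, orderOf y = s.card / s.card.gcd 2 ∧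
      (y : Perm α).support = s := by
  obtain ⟨ρ, h1, h2⟩ := exists_sq_support_eq hs
  refine ⟨⟨ρ ^ 2, by simp [mem_alternatingGroup]⟩, ?_, h2⟩
  rw [← Subgroup.orderOf_coe, h1]

theorem card_support_of_mem_cycleFactorsFinset {x c : Perm α} (hx : (orderOf x).Prime)
    (hc : c ∈ x.cycleFactorsFinset) : c.support.card = orderOf x := by
  obtain ⟨n, hn⟩ := cycleType_prime_order hx
  refine Multiset.eq_of_mem_replicate (n := n + 1) ?_
  rw [← hn, cycleType_def]
  exact Multiset.mem_map_of_mem (Finset.card ∘ support) hc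

theorem card_support_eq_card_cycleFactorsFinset_mul {x : Perm α} (hx : (orderOf x).Prime) :
    x.support.card = x.cycleFactorsFinset.card * orderOf x := by
  have hcard : x.cycleType.card = x.cycleFactorsFinset.card := by
    rw [cycleType_def, Multiset.card_map]; rfl
  obtain ⟨n, hn⟩ := cycleType_prime_order hx
  rw [← hcard, ← sum_cycleType, hn, Multiset.sum_replicate, Multiset.card_replicate, smul_eq_mul]

/-- The cycles in a set `C` of cycles of a permutation of prime order are permuted by an even
permutation commuting with it. -/
theorem exists_even_commute_support_eq_biUnion {x : alternatingGroup α} (hx : (orderOf x).Prime)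
    {C : Finset (Perm α)} (hC : C ⊆ (x : Perm α).cycleFactorsFinset) (hC3 : 3 ≤ C.card) :
    ∃ y : alternatingGroup α, orderOf y = C.card / C.card.gcd 2 ∧ Commute x y ∧
      (y : Perm α).support = C.biUnion support := by
  obtain ⟨g, hg⟩ := x
  rw [← Subgroup.orderOf_coe] at hx
  change (orderOf g).Prime at hx
  change C ⊆ g.cycleFactorsFinset at hC
  obtain ⟨a⟩ := Basis.nonempty g
  have hcard : (C.subtype (· ∈ g.cycleFactorsFinset)).card = C.card := by
    rw [Finset.card_subtype, Finset.filter_true_of_mem hC]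
  obtain ⟨ρ, h1, h2⟩ := exists_sq_support_eq (s := C.subtype (· ∈ g.cycleFactorsFinset))
    (by rw [hcard]; exact hC3)
  -- All cycles have the same length, so every permutation of them is induced by the centralizer of
  -- `g`.
  have hmem : ∀ τ : Perm g.cycleFactorsFinset, τ ∈ OnCycleFactors.range_toPermHom' g := fun τ c =>
    by rw [card_support_of_mem_cycleFactorsFinset hx (τ c).2,
      card_support_of_mem_cycleFactorsFinset hx c.2]
  -- `toPermHom` undoes the lift, so lifting preserves orders.
  have hinj : Function.Injective a.toCentralizer := fun τ σ h => by
    apply Subtype.ext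
    rw [← Basis.toPermHom_apply_toCentralizer a τ, h, Basis.toPermHom_apply_toCentralizer]
  let ρ' : OnCycleFactors.range_toPermHom' g := ⟨ρ, hmem ρ⟩
  have hval : ((a.toCentralizer (ρ' ^ 2) : Subgroup.centralizer {g}) : Perm α) =
      a.ofPermHom (ρ' ^ 2) := rfl
  refine ⟨⟨a.ofPermHom (ρ' ^ 2), by simp [mem_alternatingGroup]⟩, ?_, ?_, ?_⟩
  · rw [← hcard, ← h1, ← Subgroup.orderOf_coe]
    change orderOf (a.ofPermHom (ρ' ^ 2)) = _
    rw [← hval, Subgroup.orderOf_coe, orderOf_injective _ hinj, ← Subgroup.orderOf_coe]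
    rfl
  · apply Subtype.ext
    exact (Subgroup.mem_centralizer_singleton_iff.1 (a.ofPermHom_mem_centralizer (ρ' ^ 2))).symm
  · change (a.ofPermHom (ρ' ^ 2)).support = _
    rw [Basis.ofPermHom_support]
    ext z
    have h2' : ((ρ' ^ 2 : OnCycleFactors.range_toPermHom' g) :
      Perm g.cycleFactorsFinset).support = _ := h2
    rw [h2']
    simp only [Finset.mem_biUnion, Finset.mem_subtype]
    exact ⟨fun ⟨c, hc, hz⟩ => ⟨c, hc, hz⟩, fun ⟨c, hc, hz⟩ => ⟨⟨c, hC hc⟩, hc, hz⟩⟩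

theorem card_biUnion_support {x : Perm α} (hx : (orderOf x).Prime) {C : Finset (Perm α)}
    (hC : C ⊆ x.cycleFactorsFinset) : (C.biUnion support).card = C.card * orderOf x := by
  rw [Finset.card_biUnion]
  · exact Finset.sum_const_nat fun c hc => card_support_of_mem_cycleFactorsFinset hx (hC hc)
  · exact fun c hc d hd h =>
      (x.cycleFactorsFinset_pairwise_disjoint (hC hc) (hC hd) h).disjoint_support

/-- At most `s.card` cycles meet a set `s`. -/
theorem exists_cycles_disjoint {x : Perm α} {s : Finset α} {k : ℕ}
    (h : s.card + k ≤ x.cycleFactorsFinset.card) :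
    ∃ C ⊆ x.cycleFactorsFinset, C.card = k ∧ _root_.Disjoint (C.biUnion support) s := by
  have h1 : (s.image x.cycleOf).card ≤ s.card := Finset.card_image_le
  have h2 := Finset.le_card_sdiff (s.image x.cycleOf) x.cycleFactorsFinset
  obtain ⟨C, hC, hCk⟩ := Finset.exists_subset_card_eq
    (s := x.cycleFactorsFinset \ s.image x.cycleOf) (n := k) (by omega)
  refine ⟨C, hC.trans Finset.sdiff_subset, hCk, ?_⟩
  rw [Finset.disjoint_left]
  intro z hz hzs
  obtain ⟨c, hc, hzc⟩ := Finset.mem_biUnion.1 hz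
  have := Finset.mem_sdiff.1 (hC hc)
  rw [cycle_is_cycleOf hzc this.1] at this
  exact this.2 (Finset.mem_image_of_mem _ hzs)

end Equiv.Perm

/-! ### Links between even permutations of small order. -/

namespace alternatingGroup

open Equiv.Perm

variable {α : Type*} [Fintype α] [DecidableEq α] {x y : alternatingGroup α}

theorem commute_of_disjoint_support
    (h : Disjoint (x : Equiv.Perm α).support (y : Equiv.Perm α).support) : Commute x y :=
  Subtype.ext (disjoint_iff_disjoint_support.2 h).commute.eq

theorem powerLinked_of_disjoint_support (hx : (orderOf x).Prime) (hy : (orderOf y).Prime)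
    (hne : orderOf x ≠ orderOf y)
    (h : Disjoint (x : Equiv.Perm α).support (y : Equiv.Perm α).support) : PowerLinked 1 x y :=
  .of_commute hx hy hne (commute_of_disjoint_support h)

/-- Elements of orders `2` or `3` whose supports miss five common points are linked through a
`5`-cycle. -/
theorem powerLinked_two_of_five_le {s : Finset α} (hs : 5 ≤ s.card)
    (hx : orderOf x = 2 ∨ orderOf x = 3) (hy : orderOf y = 2 ∨ orderOf y = 3)
    (hxs : Disjoint (x : Equiv.Perm α).support s) (hys : Disjoint (y : Equiv.Perm α).support s) :
    PowerLinked 2 x y := by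
  obtain ⟨t, hts, ht⟩ := Finset.exists_subset_card_eq hs
  obtain ⟨z, hz, hzt⟩ := exists_even_support_eq (s := t) (by omega)
  replace hz : orderOf z = 5 := by rw [hz, ht]; norm_num
  rw [← hzt] at hts
  have key : ∀ w : alternatingGroup α, (orderOf w = 2 ∨ orderOf w = 3) →
      Disjoint (w : Equiv.Perm α).support s → PowerLinked 1 w z := fun w hw hws => by
    refine powerLinked_of_disjoint_support ?_ (by rw [hz]; norm_num) (by omega)
      (hws.mono_right hts)
    rcases hw with hw | hw <;> rw [hw] <;> norm_num
  exact (key x hx hxs).trans (key y hy hys).symm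

/-- Elements of order `3` whose supports miss four common points are linked through a product of
two transpositions. -/
theorem powerLinked_two_of_four_le {s : Finset α} (hs : 4 ≤ s.card)
    (hx : orderOf x = 3) (hy : orderOf y = 3)
    (hxs : Disjoint (x : Equiv.Perm α).support s) (hys : Disjoint (y : Equiv.Perm α).support s) :
    PowerLinked 2 x y := by
  obtain ⟨t, hts, ht⟩ := Finset.exists_subset_card_eq hs
  obtain ⟨z, hz, hzt⟩ := exists_even_support_eq (s := t) (by omega)
  replace hz : orderOf z = 2 := by rw [hz, ht]; norm_num
  rw [← hzt] at hts
  have key : ∀ w : alternatingGroup α, orderOf w = 3 →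
      Disjoint (w : Equiv.Perm α).support s → PowerLinked 1 w z := fun w hw hws =>
    powerLinked_of_disjoint_support (by rw [hw]; norm_num) (by rw [hz]; norm_num) (by omega)
      (hws.mono_right hts)
  exact (key x hx hxs).trans (key y hy hys).symm

theorem exists_orderOf_two_of_orderOf_three (hα : 15 ≤ Fintype.card α) (hx : orderOf x = 3) :
    ∃ y : alternatingGroup α, orderOf y = 2 ∧ PowerLinked 1 x y ∧
      (y : Equiv.Perm α).support.card ≤ 12 := by
  have hxp : (orderOf x).Prime := by rw [hx]; norm_num
  have hxp' : (orderOf (x : Equiv.Perm α)).Prime := by rwa [Subgroup.orderOf_coe]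
  by_cases hf : 4 ≤ (x : Equiv.Perm α).supportᶜ.card
  · obtain ⟨t, hts, ht⟩ := Finset.exists_subset_card_eq hf
    obtain ⟨y, hy, hyt⟩ := exists_even_support_eq (s := t) (by omega)
    replace hy : orderOf y = 2 := by rw [hy, ht]; norm_num
    refine ⟨y, hy, powerLinked_of_disjoint_support hxp (by rw [hy]; norm_num) (by omega) ?_,
      by rw [hyt]; omega⟩
    rw [hyt]
    exact disjoint_compl_right.mono_right hts
  -- At most three of at least 15 points are fixed, so there are four 3-cycles to permute.
  · have h1 := card_support_eq_card_cycleFactorsFinset_mul hxp'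
    rw [Subgroup.orderOf_coe, hx] at h1
    rw [Finset.card_compl] at hf
    obtain ⟨C, hC, hC4⟩ := Finset.exists_subset_card_eq
      (s := (x : Equiv.Perm α).cycleFactorsFinset) (n := 4) (by omega)
    obtain ⟨y, hy, hc, hys⟩ := exists_even_commute_support_eq_biUnion hxp hC (by omega)
    replace hy : orderOf y = 2 := by rw [hy, hC4]; norm_num
    refine ⟨y, hy, .of_commute hxp (by rw [hy]; norm_num) (by omega) hc, ?_⟩
    rw [hys, card_biUnion_support hxp' hC, hC4, Subgroup.orderOf_coe, hx]

theorem exists_threeCycle_of_three_le (hxp : (orderOf x).Prime) (hx : orderOf x ≠ 3)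
    (hf : 3 ≤ (x : Equiv.Perm α).supportᶜ.card) :
    ∃ y : alternatingGroup α, orderOf y = 3 ∧ PowerLinked 1 x y ∧
      (y : Equiv.Perm α).support.card = 3 := by
  obtain ⟨t, hts, ht⟩ := Finset.exists_subset_card_eq hf
  obtain ⟨y, hy, hyt⟩ := exists_even_support_eq (s := t) (by omega)
  replace hy : orderOf y = 3 := by rw [hy, ht]; norm_num
  refine ⟨y, hy, powerLinked_of_disjoint_support hxp (by rw [hy]; norm_num) (by omega) ?_,
    by rw [hyt, ht]⟩
  rw [hyt]
  exact disjoint_compl_right.mono_right hts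

/-! ### Neighbourhoods of elements of order other than 3. -/

/-- Every large set of points meets the fixed points of some neighbour of `x` of order `3` in at
least a quarter of its size. -/
def HasSparseThree (x : alternatingGroup α) : Prop :=
  ∀ s : Finset α, 8 ≤ s.card → ∃ y : alternatingGroup α, orderOf y = 3 ∧ PowerLinked 1 x y ∧
    s.card ≤ 4 * (s \ (y : Equiv.Perm α).support).card

theorem hasSparseThree_of_three_le (hxp : (orderOf x).Prime) (hx : orderOf x ≠ 3)
    (hf : 3 ≤ (x : Equiv.Perm α).supportᶜ.card) : HasSparseThree x := by
  intro s hs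
  obtain ⟨y, hy, hxy, hy3⟩ := exists_threeCycle_of_three_le hxp hx hf
  have := Finset.le_card_sdiff (y : Equiv.Perm α).support s
  exact ⟨y, hy, hxy, by omega⟩

/-- Fix four cycles and let `y` permute three of them. A point lies on at most one cycle, so it is
avoided for some choice of the omitted cycle; by pigeonhole, one choice avoids a quarter of `s`. -/
theorem hasSparseThree_of_four_le (hxp : (orderOf x).Prime) (hx : orderOf x ≠ 3)
    (hm : 4 ≤ (x : Equiv.Perm α).cycleFactorsFinset.card) : HasSparseThree x := by
  intro s hs
  obtain ⟨C, hC, hC4⟩ := Finset.exists_subset_card_eq hm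
  have hsub : s ⊆ C.biUnion fun c => s \ (C.erase c).biUnion support := by
    intro z hz
    simp only [Finset.mem_biUnion, Finset.mem_sdiff, Finset.mem_erase, not_exists, not_and]
    by_cases h : ∃ c ∈ C, z ∈ c.support
    · obtain ⟨c, hc, hzc⟩ := h
      refine ⟨c, hc, hz, fun d hd hzd => hd.1 ?_⟩
      rw [cycle_is_cycleOf hzd (hC hd.2), cycle_is_cycleOf hzc (hC hc)]
    · push Not at h
      obtain ⟨c, hc⟩ : C.Nonempty := Finset.card_pos.1 (by omega)
      exact ⟨c, hc, hz, fun d hd => h d hd.2⟩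
  obtain ⟨c, hc, hcs⟩ : ∃ c ∈ C, s.card ≤ 4 * (s \ (C.erase c).biUnion support).card := by
    by_contra! h
    have h1 := (Finset.card_le_card hsub).trans Finset.card_biUnion_le
    have h2 := Finset.sum_lt_sum_of_nonempty (Finset.card_pos.1 (by omega)) h
    rw [← Finset.mul_sum, Finset.sum_const, hC4, smul_eq_mul] at h2
    omega
  have hc3 : (C.erase c).card = 3 := by rw [Finset.card_erase_of_mem hc, hC4]
  obtain ⟨y, hy, hxy, hys⟩ := exists_even_commute_support_eq_biUnion hxp
    ((C.erase_subset c).trans hC) hc3.ge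
  replace hy : orderOf y = 3 := by rw [hy, hc3]; norm_num
  exact ⟨y, hy, .of_commute hxp (by rw [hy]; norm_num) (by omega) hxy, by rwa [hys]⟩

/-- Around `x`, at distance two links, there are elements of orders `2` and `5` that avoid any
given small set of points. -/
def HasFlexiblePair (x : alternatingGroup α) : Prop :=
  ∀ s : Finset α, s.card ≤ 12 →
    (∃ z : alternatingGroup α, orderOf z = 2 ∧ PowerLinked 2 x z ∧
      (z : Equiv.Perm α).support.card ≤ 12 ∧ Disjoint (z : Equiv.Perm α).support s) ∧
    (∃ z : alternatingGroup α, orderOf z = 5 ∧ PowerLinked 2 x z ∧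
      Disjoint (z : Equiv.Perm α).support s)

/-- Rotating the three cycles gives `y` with at least 17 cycles of length 3. Twelve points meet at
most 12 of these; permuting 4 or 5 of the others gives order 2 or 5. -/
theorem hasFlexiblePair_of_card_eq_three (hxp : (orderOf x).Prime) (hx : orderOf x ≠ 3)
    (hm : (x : Equiv.Perm α).cycleFactorsFinset.card = 3)
    (hs : 49 ≤ (x : Equiv.Perm α).support.card) : HasFlexiblePair x := by
  obtain ⟨y, hy, hxy, hys⟩ := exists_even_commute_support_eq_biUnion hxp subset_rfl hm.ge
  replace hy : orderOf y = 3 := by rw [hy, hm]; norm_num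
  have hyp : (orderOf y).Prime := by rw [hy]; norm_num
  have hyp' : (orderOf (y : Equiv.Perm α)).Prime := by rwa [Subgroup.orderOf_coe]
  have hxp' : (orderOf (x : Equiv.Perm α)).Prime := by rwa [Subgroup.orderOf_coe]
  have hlink : PowerLinked 1 x y := .of_commute hxp hyp (by omega) hxy
  have h17 : 17 ≤ (y : Equiv.Perm α).cycleFactorsFinset.card := by
    have h1 := card_support_eq_card_cycleFactorsFinset_mul hyp'
    rw [hys, card_biUnion_support hxp' subset_rfl,
      ← card_support_eq_card_cycleFactorsFinset_mul hxp', Subgroup.orderOf_coe, hy] at h1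
    omega
  intro s hs
  constructor
  · obtain ⟨C, hC, hCk, hCs⟩ := exists_cycles_disjoint (x := (y : Equiv.Perm α)) (s := s) (k := 4)
      (by omega)
    obtain ⟨z, hz, hyz, hzs⟩ := exists_even_commute_support_eq_biUnion hyp hC (by omega)
    replace hz : orderOf z = 2 := by rw [hz, hCk]; norm_num
    refine ⟨z, hz, hlink.trans (.of_commute hyp (by rw [hz]; norm_num) (by omega) hyz), ?_,
      by rwa [hzs]⟩
    rw [hzs, card_biUnion_support hyp' hC, hCk, Subgroup.orderOf_coe, hy]
  · obtain ⟨C, hC, hCk, hCs⟩ := exists_cycles_disjoint (x := (y : Equiv.Perm α)) (s := s) (k := 5)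
      (by omega)
    obtain ⟨z, hz, hyz, hzs⟩ := exists_even_commute_support_eq_biUnion hyp hC (by omega)
    replace hz : orderOf z = 5 := by rw [hz, hCk]; norm_num
    exact ⟨z, hz, hlink.trans (.of_commute hyp (by rw [hz]; norm_num) (by omega) hyz),
      by rwa [hzs]⟩

/-! ### Joining the types pairwise. -/

theorem HasSparseThree.powerLinked_four (hα : 49 ≤ Fintype.card α) (hx : HasSparseThree x)
    (hy : HasSparseThree y) : PowerLinked 4 x y := by
  obtain ⟨x', hx', hxx', hxs⟩ := hx Finset.univ (by rw [Finset.card_univ]; omega)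
  rw [Finset.card_univ] at hxs
  obtain ⟨y', hy', hyy', hys⟩ := hy (Finset.univ \ (x' : Equiv.Perm α).support) (by omega)
  -- Of 49 points, `x'` misses at least 13, and `y'` misses at least 4 of those.
  have h : PowerLinked 2 x' y' := powerLinked_two_of_four_le
    (s := (Finset.univ \ (x' : Equiv.Perm α).support) \ (y' : Equiv.Perm α).support) (by omega) hx' hy'
    (Finset.disjoint_sdiff.mono_right Finset.sdiff_subset) Finset.disjoint_sdiff
  exact (hxx'.trans h).trans hyy'.symm

/-- The link between an element of order `2` with small support and `y`. -/
theorem HasSparseThree.powerLinked_three (hα : 32 ≤ Fintype.card α) (hy : HasSparseThree y)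
    (hx : orderOf x = 2) (hxs : (x : Equiv.Perm α).support.card ≤ 12) : PowerLinked 3 x y := by
  have h1 := Finset.card_compl (x : Equiv.Perm α).support
  obtain ⟨y', hy', hyy', hys⟩ := hy (x : Equiv.Perm α).supportᶜ (by omega)
  -- At least 20 points lie off the support of `x`, and `y'` misses 5 of them.
  have h : PowerLinked 2 x y' := powerLinked_two_of_five_le
    (s := (x : Equiv.Perm α).supportᶜ \ (y' : Equiv.Perm α).support) (by omega) (.inl hx) (.inr hy')
    (disjoint_compl_right.mono_right Finset.sdiff_subset) Finset.disjoint_sdiff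
  exact h.trans hyy'.symm

theorem HasSparseThree.powerLinked_four_of_orderOf_three (hα : 32 ≤ Fintype.card α)
    (hx : orderOf x = 3) (hy : HasSparseThree y) : PowerLinked 4 x y := by
  obtain ⟨x', hx', hxx', hxs⟩ := exists_orderOf_two_of_orderOf_three (by omega) hx
  exact hxx'.trans (hy.powerLinked_three hα hx' hxs)

theorem powerLinked_four_of_orderOf_three (hα : 29 ≤ Fintype.card α)
    (hx : orderOf x = 3) (hy : orderOf y = 3) : PowerLinked 4 x y := by
  obtain ⟨x', hx', hxx', hxs⟩ := exists_orderOf_two_of_orderOf_three (by omega) hx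
  obtain ⟨y', hy', hyy', hys⟩ := exists_orderOf_two_of_orderOf_three (by omega) hy
  have h1 := Finset.card_compl ((x' : Equiv.Perm α).support ∪ (y' : Equiv.Perm α).support)
  have h2 := Finset.card_union_le (x' : Equiv.Perm α).support (y' : Equiv.Perm α).support
  have h : PowerLinked 2 x' y' := powerLinked_two_of_five_le
    (s := ((x' : Equiv.Perm α).support ∪ (y' : Equiv.Perm α).support)ᶜ) (by omega)
    (.inl hx') (.inl hy') (disjoint_compl_right.mono_left Finset.subset_union_left)
    (disjoint_compl_right.mono_left Finset.subset_union_right)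
  exact (hxx'.trans h).trans hyy'.symm

theorem HasFlexiblePair.powerLinked_four_of_orderOf_three (hα : 15 ≤ Fintype.card α)
    (hx : HasFlexiblePair x) (hy : orderOf y = 3) : PowerLinked 4 x y := by
  obtain ⟨y', hy', hyy', hys⟩ := exists_orderOf_two_of_orderOf_three hα hy
  obtain ⟨z, hz, hxz, hzs⟩ := (hx _ hys).2
  have h : PowerLinked 1 z y' := powerLinked_of_disjoint_support (by rw [hz]; norm_num)
    (by rw [hy']; norm_num) (by omega) hzs
  exact (hxz.trans h).trans hyy'.symm

theorem HasFlexiblePair.powerLinked_four_of_three_le (hx : HasFlexiblePair x)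
    (hyp : (orderOf y).Prime) (hy : orderOf y ≠ 3)
    (hf : 3 ≤ (y : Equiv.Perm α).supportᶜ.card) : PowerLinked 4 x y := by
  obtain ⟨y', hy', hyy', hys⟩ := exists_threeCycle_of_three_le hyp hy hf
  obtain ⟨z, hz, hxz, -, hzs⟩ := (hx (y' : Equiv.Perm α).support (by omega)).1
  have h : PowerLinked 1 z y' := powerLinked_of_disjoint_support (by rw [hz]; norm_num)
    (by rw [hy']; norm_num) (by omega) hzs
  exact (hxz.trans h).trans hyy'.symm

theorem HasFlexiblePair.powerLinked_five_of_hasSparseThree (hα : 32 ≤ Fintype.card α)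
    (hx : HasFlexiblePair x) (hy : HasSparseThree y) : PowerLinked 5 x y := by
  obtain ⟨z, hz, hxz, hz12, -⟩ := (hx ∅ (by simp)).1
  exact hxz.trans (hy.powerLinked_three hα hz hz12)

theorem HasFlexiblePair.powerLinked_five (hx : HasFlexiblePair x) (hy : HasFlexiblePair y) :
    PowerLinked 5 x y := by
  obtain ⟨z, hz, hxz, hz12, -⟩ := (hx ∅ (by simp)).1
  obtain ⟨w, hw, hyw, hws⟩ := (hy _ hz12).2
  have h : PowerLinked 1 z w := powerLinked_of_disjoint_support (by rw [hz]; norm_num)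
    (by rw [hw]; norm_num) (by omega) hws.symm
  exact (hxz.trans h).trans hyw.symm

end alternatingGroup

/-! ### Classification by cycles and fixed points, and conclusion. -/

theorem numCycles_eq_card_cycleFactorsFinset {n : ℕ} (σ : Equiv.Perm (Fin n)) :
    numCycles σ = σ.cycleFactorsFinset.card := by
  rw [numCycles, Equiv.Perm.cycleType_def, Multiset.card_map]
  rfl

theorem numCycles_mul_orderOf_add_numFixed {n : ℕ} {x : alternatingGroup (Fin n)}
    (hx : (orderOf x).Prime) :
    numCycles (x : Equiv.Perm (Fin n)) * orderOf x + numFixed (x : Equiv.Perm (Fin n)) = n := by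
  have h := Equiv.Perm.card_support_eq_card_cycleFactorsFinset_mul
    (x := (x : Equiv.Perm (Fin n))) (by rwa [Subgroup.orderOf_coe])
  rw [numCycles_eq_card_cycleFactorsFinset, numFixed, ← Subgroup.orderOf_coe, ← h,
    Finset.card_add_card_compl, Fintype.card_fin]

namespace alternatingGroup

/-- The elements of prime order of the alternating group, by their order and the number of their
cycles and fixed points. -/
theorem classification_of_prime_order {n : ℕ} (hn : 51 < n)
    (h0 : ¬ n.Prime) (h1 : ¬ (n - 1).Prime) (h2 : ¬ (n - 2).Prime)
    (hhalf : ∀ r : ℕ, r.Prime → n ≠ 2 * r ∧ n - 1 ≠ 2 * r ∧ n - 2 ≠ 2 * r)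
    {x : alternatingGroup (Fin n)} (hx : (orderOf x).Prime) :
    orderOf x = 3 ∨
    (orderOf x ≠ 3 ∧ 3 ≤ numFixed (x : Equiv.Perm (Fin n)) ∧ HasSparseThree x) ∨
    (numFixed (x : Equiv.Perm (Fin n)) < 3 ∧ 4 ≤ numCycles (x : Equiv.Perm (Fin n)) ∧
      HasSparseThree x) ∨
    (numFixed (x : Equiv.Perm (Fin n)) < 3 ∧ numCycles (x : Equiv.Perm (Fin n)) = 3 ∧
      HasFlexiblePair x) := by
  by_cases hx3 : orderOf x = 3
  · exact .inl hx3
  refine .inr ?_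
  by_cases hf : 3 ≤ numFixed (x : Equiv.Perm (Fin n))
  · exact .inl ⟨hx3, hf, hasSparseThree_of_three_le hx hx3 hf⟩
  refine .inr ?_
  push Not at hf
  by_cases hm : 4 ≤ numCycles (x : Equiv.Perm (Fin n))
  · exact .inl ⟨hf, hm, hasSparseThree_of_four_le hx hx3
      (numCycles_eq_card_cycleFactorsFinset _ ▸ hm)⟩
  have hsum := numCycles_mul_orderOf_add_numFixed hx
  have hhalf' := hhalf _ hx
  have hm3 : numCycles (x : Equiv.Perm (Fin n)) = 3 := by
    generalize numCycles (x : Equiv.Perm (Fin n)) = m at *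
    generalize numFixed (x : Equiv.Perm (Fin n)) = f at *
    generalize orderOf x = p at *
    have hp0 : p ≠ n := fun h => h0 (h ▸ hx)
    have hp1 : p ≠ n - 1 := fun h => h1 (h ▸ hx)
    have hp2 : p ≠ n - 2 := fun h => h2 (h ▸ hx)
    -- One or two cycles would make `n - f` equal to `p` or `2 * p` with `f ≤ 2`, which is excluded.
    interval_cases m <;> omega
  refine .inr ⟨hf, hm3, hasFlexiblePair_of_card_eq_three hx hx3
    (numCycles_eq_card_cycleFactorsFinset _ ▸ hm3) ?_⟩
  have := Finset.card_add_card_compl (x : Equiv.Perm (Fin n)).support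
  rw [Fintype.card_fin] at this
  change _ + numFixed (x : Equiv.Perm (Fin n)) = n at this
  omega

end alternatingGroup

open alternatingGroup in
theorem mainTheorem5 (n : ℕ) (hn : 51 < n)
    (h0 : ¬ n.Prime) (h1 : ¬ (n - 1).Prime) (h2 : ¬ (n - 2).Prime)
    -- none of n / 2, (n - 1) / 2, (n - 2) / 2 (exact quotients) is a prime
    (hhalf : ∀ r : ℕ, r.Prime → n ≠ 2 * r ∧ n - 1 ≠ 2 * r ∧ n - 2 ≠ 2 * r)
    (p q : ℕ) (hp : p.Prime) (hq : q.Prime) (hpq : p ≤ q)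
    (α β : alternatingGroup (Fin n)) (hα : orderOf α = p) (hβ : orderOf β = q) :
    ((numCycles (β : Equiv.Perm (Fin n)) = 3 ∧ numFixed (β : Equiv.Perm (Fin n)) < 3 ∧
        numFixed (α : Equiv.Perm (Fin n)) < 3) →
      (properPowerGraph (alternatingGroup (Fin n))).Reachable
          ⟨α, ne_one_of_orderOf_prime hp hα⟩ ⟨β, ne_one_of_orderOf_prime hq hβ⟩ ∧
        (properPowerGraph (alternatingGroup (Fin n))).dist
          ⟨α, ne_one_of_orderOf_prime hp hα⟩ ⟨β, ne_one_of_orderOf_prime hq hβ⟩ ≤ 10) ∧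
    (¬ (numCycles (β : Equiv.Perm (Fin n)) = 3 ∧ numFixed (β : Equiv.Perm (Fin n)) < 3 ∧
        numFixed (α : Equiv.Perm (Fin n)) < 3) →
      (properPowerGraph (alternatingGroup (Fin n))).Reachable
          ⟨α, ne_one_of_orderOf_prime hp hα⟩ ⟨β, ne_one_of_orderOf_prime hq hβ⟩ ∧
        (properPowerGraph (alternatingGroup (Fin n))).dist
          ⟨α, ne_one_of_orderOf_prime hp hα⟩ ⟨β, ne_one_of_orderOf_prime hq hβ⟩ ≤ 8) := by
  have key : PowerLinked 4 α β ∨ (PowerLinked 5 α β ∧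
      numCycles (β : Equiv.Perm (Fin n)) = 3 ∧ numFixed (β : Equiv.Perm (Fin n)) < 3 ∧
        numFixed (α : Equiv.Perm (Fin n)) < 3) := by
    have hn' : 49 ≤ Fintype.card (Fin n) := by rw [Fintype.card_fin]; omega
    have hpα : (orderOf α).Prime := hα ▸ hp
    have hpβ : (orderOf β).Prime := hβ ▸ hq
    rcases classification_of_prime_order hn h0 h1 h2 hhalf hpα with
      a3 | ⟨a3, af, a⟩ | ⟨af, am, a⟩ | ⟨af, am, a⟩ <;>
    rcases classification_of_prime_order hn h0 h1 h2 hhalf hpβ with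
      b3 | ⟨b3, bf, b⟩ | ⟨bf, bm, b⟩ | ⟨bf, bm, b⟩
    · exact .inl (powerLinked_four_of_orderOf_three (by omega) a3 b3)
    · exact .inl (b.powerLinked_four_of_orderOf_three (by omega) a3)
    · exact .inl (b.powerLinked_four_of_orderOf_three (by omega) a3)
    · exact .inl (b.powerLinked_four_of_orderOf_three (by omega) a3).symm
    · exact .inl (a.powerLinked_four_of_orderOf_three (by omega) b3).symm
    · exact .inl (a.powerLinked_four hn' b)
    · exact .inl (a.powerLinked_four hn' b)
    · exact .inl (b.powerLinked_four_of_three_le hpα a3 af).symm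
    · exact .inl (a.powerLinked_four_of_orderOf_three (by omega) b3).symm
    · exact .inl (a.powerLinked_four hn' b)
    · exact .inl (a.powerLinked_four hn' b)
    · exact .inr ⟨(b.powerLinked_five_of_hasSparseThree (by omega) a).symm, bm, bf, af⟩
    · exact .inl (a.powerLinked_four_of_orderOf_three (by omega) b3)
    · exact .inl (a.powerLinked_four_of_three_le hpβ b3 bf)
    -- This case is void: `4 * q ≤ n ≤ 3 * p + 2` and `p ≤ q` force `q ≤ 2`, against `n > 51`.
    · have hA := numCycles_mul_orderOf_add_numFixed hpα
      have hB := numCycles_mul_orderOf_add_numFixed hpβ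
      have := Nat.mul_le_mul_right (orderOf β) bm
      rw [am] at hA
      omega
    · exact .inr ⟨a.powerLinked_five b, bm, bf, af⟩
  have hα1 := ne_one_of_orderOf_prime hp hα
  have hβ1 := ne_one_of_orderOf_prime hq hβ
  rcases key with h | ⟨h, hexc⟩
  · obtain ⟨hr, hd⟩ := h.reachable_and_dist_le hα1 hβ1
    exact ⟨fun _ => ⟨hr, hd.trans (by norm_num)⟩, fun _ => ⟨hr, hd⟩⟩
  · exact ⟨fun _ => h.reachable_and_dist_le hα1 hβ1, fun hne => absurd hexc hne⟩
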